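/- Let $\kappa$ be a regular uncountable cardinal. For $f,g\in\kappa^\kappa$ write $f\le^* g$ if there is $\alpha<\kappa$ such that $f(\beta)\le g(\beta)$ for all $\beta$ with $\alpha<\beta<\kappa$, and let $$\mathfrak d_\kappa=\min\{|D| : D\subseteq\kappa^\kappa \text{ and for every } g\in\kappa^\kappa \text{ there is } f\in D \text{ with } g\le^* f\}.$$ Let $\mathbb P$ be a $\kappa$-cc poset, i.e. every set of pairwise incompatible conditions of $\mathbb P$ has size less than $\kappa$. Then: 1. $\Vdash_{\mathbb P}\ \mathfrak d_\kappa^V=\mathfrak d_\kappa$; that is, $\mathbb P$ forces that the cardinal $\mathfrak d_\kappa$ computed in the ground model $V$ is the value of $\mathfrak d_\kappa$ computed in the generic extension. 2. $\mathbb P$ is $\kappa^\kappa$-bounding, in the following uniform sense: for every $\mathbb P$-name $\dot x$ there is a function $z\in\kappa^\kappa$ in the ground model such that for every $\alpha<\kappa$, $\Vdash_{\mathbb P}$ "if $\dot x\in\kappa^\kappa$, then $\dot x(\alpha)\le z(\alpha)$". -/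

import Mathlib

universe u v

namespace KForcing

/-! ### The dominating number, computed in the ground model

The ground model `V` is the universe of sets of type `Type u`; the points of the cardinal `κ` are
the elements of the well-order `κ.ord.ToType`. -/

/-- `κ^κ` in the ground model: all functions from the initial ordinal `κ` to itself. -/
abbrev Baire (κ : Cardinal.{u}) : Type u := κ.ord.ToType → κ.ord.ToType

/-- Eventual domination `f ≤* g` on `κ^κ`. -/
def EventuallyLe {κ : Cardinal.{u}} (f g : Baire κ) : Prop :=
  ∃ a, ∀ b, a < b → f b ≤ g b

/-- `D` is a dominating family in `κ^κ`. -/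
def IsDominating {κ : Cardinal.{u}} (D : Set (Baire κ)) : Prop :=
  ∀ g, ∃ f ∈ D, EventuallyLe g f

/-- The dominating number `𝔡_κ` of the ground model. (The set of cardinals is nonempty, as the
set of all functions is dominating, so this infimum is a minimum.) -/
noncomputable def dominatingNumber (κ : Cardinal.{u}) : Cardinal.{u} :=
  sInf {c | ∃ D : Set (Baire κ), IsDominating D ∧ Cardinal.mk D = c}

/-- `P` is `κ`-cc: every antichain (a set of pairwise incompatible conditions, i.e. no two distinct
members have a common lower bound) has size less than `κ`. -/
def ChainCondition (κ : Cardinal.{u}) (P : Type u) [Preorder P] : Prop :=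
  ∀ A : Set P, IsStrongAntichain (· ≥ ·) A → Cardinal.mk A < κ

/-! ### Formulas of the language of set theory

`Formula N` is the type of formulas of the language `{∈, =}` with parameters from `N`; a quantifier
is given by the family of its instances. -/

/-- Formulas of set theory with parameters in `N`. -/
inductive Formula (N : Type v) : Type v
  | mem (a b : N) : Formula N
  | eq (a b : N) : Formula N
  | neg (φ : Formula N) : Formula N
  | and (φ ψ : Formula N) : Formula N
  | or (φ ψ : Formula N) : Formula N
  | imp (φ ψ : Formula N) : Formula N
  | all (φ : N → Formula N) : Formula N
  | ex (φ : N → Formula N) : Formula N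

namespace Formula

variable {N : Type v}

/-- `φ ↔ ψ`. -/
def iff (φ ψ : Formula N) : Formula N := and (imp φ ψ) (imp ψ φ)

/-- `∀ x ∈ a, φ x`. -/
def ball (a : N) (φ : N → Formula N) : Formula N := all fun x => imp (mem x a) (φ x)

/-- `∃ x ∈ a, φ x`. -/
def bex (a : N) (φ : N → Formula N) : Formula N := ex fun x => and (mem x a) (φ x)

/-- `z = {x, y}`. -/
def isPair (z x y : N) : Formula N := all fun w => iff (mem w z) (or (eq w x) (eq w y))

/-- `z = (x, y) = {{x}, {x, y}}`, the Kuratowski ordered pair. -/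
def isOrderedPair (z x y : N) : Formula N :=
  ex fun s => ex fun t => and (isPair s x x) (and (isPair t x y) (isPair z s t))

/-- `(x, y) ∈ f`, that is, `f(x) = y` when `f` is a function. -/
def maps (f x y : N) : Formula N := bex f fun z => isOrderedPair z x y

/-- `f` is a function from `a` to `b`. -/
def isFunction (f a b : N) : Formula N :=
  and (ball f fun z => bex a fun x => bex b fun y => isOrderedPair z x y)
    (and (ball a fun x => bex b fun y => maps f x y)
      (all fun x => all fun y => all fun y' => imp (and (maps f x y) (maps f x y')) (eq y y')))

/-- `f` is a bijection from `a` onto `b`. -/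
def isBijection (f a b : N) : Formula N :=
  and (isFunction f a b)
    (and (all fun x => all fun x' => all fun y => imp (and (maps f x y) (maps f x' y)) (eq x x'))
      (ball b fun y => bex a fun x => maps f x y))

/-- `a` and `b` are equinumerous. -/
def equinumerous (a b : N) : Formula N := ex fun f => isBijection f a b

/-- `a` is a transitive set. -/
def isTransitive (a : N) : Formula N := ball a fun x => ball x fun y => mem y a

/-- `a` is an ordinal: a transitive set of transitive sets. -/
def isOrdinal (a : N) : Formula N := and (isTransitive a) (ball a isTransitive)

/-- `m = |D|`: `m` is the least ordinal equinumerous with `D`. -/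
def isCardinality (m D : N) : Formula N :=
  and (isOrdinal m) (and (equinumerous m D) (ball m fun a => neg (equinumerous a D)))

/-- `x ≤ y` for ordinals `x`, `y`. -/
def ordLe (x y : N) : Formula N := or (mem x y) (eq x y)

/-- `g ≤* f` for functions `g`, `f` from the ordinal `k` to itself. -/
def eventuallyLe (k g f : N) : Formula N :=
  bex k fun a => ball k fun b => imp (mem a b)
    (all fun y => all fun z => imp (and (maps g b y) (maps f b z)) (ordLe y z))

/-- `D ⊆ k^k` and every `g ∈ k^k` is eventually dominated by some `f ∈ D`. -/
def isDominating (k D : N) : Formula N :=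
  and (ball D fun f => isFunction f k k)
    (all fun g => imp (isFunction g k k) (bex D fun f => eventuallyLe k g f))

/-- `m` is the cardinality of some dominating family in `k^k`. -/
def isDominatingCardinality (k m : N) : Formula N :=
  ex fun D => and (isDominating k D) (isCardinality m D)

/-- `m = 𝔡_k = min {|D| : D ⊆ k^k is dominating}`. -/
def isDominatingNumber (k m : N) : Formula N :=
  and (isDominatingCardinality k m)
    (all fun n => imp (isDominatingCardinality k n) (neg (mem n m)))

end Formula

/-! ### Names and the forcing relation -/

/-- `P`-names: a name is a set of pairs (name, condition), given as an indexed family. -/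
inductive PName (P : Type u) : Type (u + 1)
  | mk (ι : Type u) (name : ι → PName P) (cond : ι → P) : PName P

/-- The canonical name `x̌ = {(y̌, p) : y ∈ x, p ∈ P}` of a set `x` of the ground model. -/
def check (P : Type u) : PSet.{u} → PName P
  | ⟨α, A⟩ => ⟨α × P, fun i => check P (A i.1), fun i => i.2⟩

/-- The canonical name of the (von Neumann) ordinal `o` of the ground model. -/
noncomputable def ordName (P : Type u) (o : Ordinal.{u}) : PName P := check P o.toPSet

variable {P : Type u} [Preorder P]

/-- `p ⊩ σ = τ`: below `p`, every element put into one of the two names is, on a dense set,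
equal to an element put into the other. -/
def forcesEq : PName P → PName P → P → Prop
  | ⟨_, A, c⟩, ⟨_, B, d⟩, p =>
    (∀ i, ∀ q ≤ p, q ≤ c i → ∃ r ≤ q, ∃ j, r ≤ d j ∧ forcesEq (A i) (B j) r) ∧
    (∀ j, ∀ q ≤ p, q ≤ d j → ∃ r ≤ q, ∃ i, r ≤ c i ∧ forcesEq (A i) (B j) r)

/-- `p ⊩ σ ∈ τ`: it is dense below `p` that `σ` is equal to an element put into `τ`. -/
def forcesMem (σ : PName P) : PName P → P → Prop
  | ⟨_, B, d⟩, p => ∀ q ≤ p, ∃ r ≤ q, ∃ j, r ≤ d j ∧ forcesEq σ (B j) r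

/-- The forcing relation `p ⊩ φ`, where smaller conditions are stronger. -/
def Forces : P → Formula (PName P) → Prop
  | p, .mem σ τ => forcesMem σ τ p
  | p, .eq σ τ => forcesEq σ τ p
  | p, .neg φ => ∀ q ≤ p, ¬ Forces q φ
  | p, .and φ ψ => Forces p φ ∧ Forces p ψ
  | p, .or φ ψ => ∀ q ≤ p, ∃ r ≤ q, Forces r φ ∨ Forces r ψ
  | p, .imp φ ψ => ∀ q ≤ p, Forces q φ → Forces q ψ
  | p, .all φ => ∀ σ, Forces p (φ σ)
  | p, .ex φ => ∀ q ≤ p, ∃ r ≤ q, ∃ σ, Forces r (φ σ)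

/-- `⊩_P φ`: every condition forces `φ`. -/
def Forced (φ : Formula (PName P)) : Prop := ∀ p : P, Forces p φ

end KForcing

/-! Everything rests on the bounding property. If a name is forced to be a function from κ to κ,
choose for each possible value at a point a condition deciding that value. Conditions deciding
different values are incompatible, so by the κ-cc there are fewer than κ values, and by regularity
they are bounded below κ. Doing this in `V` at every point gives one ground-model function z above
the name (`ChainCondition.exists_bound`, `ChainCondition.exists_bounding`).

For 𝔡_κ, a ground-model dominating family D still dominates: a new g satisfies g ≤ z ≤* f for some f
in D. So the extension has a dominating family enumerated by 𝔡_κ^V. Conversely, if an ordinal o <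
𝔡_κ^V enumerated a dominating family of the extension, bounding its members one by one would give
|o| functions of `V` that dominate `V`, which is impossible
(`ChainCondition.not_forces_isBijection`).

The rest develops enough of the forcing relation to carry this out: substitution of equals, ordered
pairs, and canonical names of ordinals and functions. -/

namespace KForcing

open Formula

/-! ### Names of indexed families -/

section Names

variable {P : Type u}

/-- The name of the set whose elements are named by the `A i`. -/
def setName {ι : Type u} (A : ι → PName P) : PName P := ⟨ι × P, fun i => A i.1, fun i => i.2⟩

/-- Lets every lemma about `setName` apply to canonical names of ordinals. -/
theorem ordName_eq (o : Ordinal.{u}) :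
    ordName P o = setName fun a : o.ToType => ordName P (a.toOrd : Ordinal.{u}) := by
  rw [ordName, Ordinal.toPSet]
  rfl

end Names

section Forcing

variable {P : Type u} [Preorder P]

/-! ### Basic properties of the forcing relation -/

theorem forcesEq_mono {σ τ : PName P} {p q : P} (h : forcesEq σ τ p) (hq : q ≤ p) :
    forcesEq σ τ q := by
  cases σ; cases τ
  exact ⟨fun i r hr => h.1 i r (hr.trans hq), fun j r hr => h.2 j r (hr.trans hq)⟩

theorem forcesMem_mono {σ τ : PName P} {p q : P} (h : forcesMem σ τ p) (hq : q ≤ p) :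
    forcesMem σ τ q := by
  cases τ
  exact fun r hr => h r (hr.trans hq)

theorem Forces.mono {φ : Formula (PName P)} : ∀ {p q : P}, Forces p φ → q ≤ p → Forces q φ := by
  induction φ with
  | mem a b => exact fun h hq => forcesMem_mono h hq
  | eq a b => exact fun h hq => forcesEq_mono h hq
  | neg φ _ => exact fun h hq r hr => h r (hr.trans hq)
  | and φ ψ ih₁ ih₂ => exact fun h hq => ⟨ih₁ h.1 hq, ih₂ h.2 hq⟩
  | or φ ψ _ _ => exact fun h hq r hr => h r (hr.trans hq)
  | imp φ ψ _ _ => exact fun h hq r hr => h r (hr.trans hq)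
  | all φ ih => exact fun h hq σ => ih σ (h σ) hq
  | ex φ _ => exact fun h hq r hr => h r (hr.trans hq)

/-- A formula forced on a dense set below `p` is forced by `p`. -/
theorem Forces.of_dense {φ : Formula (PName P)} :
    ∀ {p : P}, (∀ q ≤ p, ∃ r ≤ q, Forces r φ) → Forces p φ := by
  induction φ with
  | mem a b =>
    intro p h
    cases b
    intro q hq
    obtain ⟨r, hr, hm⟩ := h q hq
    obtain ⟨s, hs, H⟩ := hm r le_rfl
    exact ⟨s, hs.trans hr, H⟩
  | eq a b =>
    intro p h
    cases a; cases b
    refine ⟨fun i q hq hi => ?_, fun j q hq hj => ?_⟩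
    · obtain ⟨r, hr, hm⟩ := h q hq
      obtain ⟨s, hs, H⟩ := hm.1 i r le_rfl (hr.trans hi)
      exact ⟨s, hs.trans hr, H⟩
    · obtain ⟨r, hr, hm⟩ := h q hq
      obtain ⟨s, hs, H⟩ := hm.2 j r le_rfl (hr.trans hj)
      exact ⟨s, hs.trans hr, H⟩
  | neg φ _ =>
    intro p h q hq hφ
    obtain ⟨r, hr, H⟩ := h q hq
    exact H r le_rfl (hφ.mono hr)
  | and φ ψ ih₁ ih₂ =>
    intro p h
    exact ⟨ih₁ fun q hq => (h q hq).imp fun r H => ⟨H.1, H.2.1⟩,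
      ih₂ fun q hq => (h q hq).imp fun r H => ⟨H.1, H.2.2⟩⟩
  | or φ ψ _ _ =>
    intro p h q hq
    obtain ⟨r, hr, H⟩ := h q hq
    obtain ⟨s, hs, H⟩ := H r le_rfl
    exact ⟨s, hs.trans hr, H⟩
  | imp φ ψ _ ih =>
    intro p h q hq hφ
    refine ih fun q' hq' => ?_
    obtain ⟨r, hr, H⟩ := h q' (hq'.trans hq)
    exact ⟨r, hr, H r le_rfl (hφ.mono (hr.trans hq'))⟩
  | all φ ih =>
    intro p h σ
    exact ih σ fun q hq => (h q hq).imp fun r H => ⟨H.1, H.2 σ⟩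
  | ex φ _ =>
    intro p h q hq
    obtain ⟨r, hr, H⟩ := h q hq
    obtain ⟨s, hs, H⟩ := H r le_rfl
    exact ⟨s, hs.trans hr, H⟩

theorem Forces.or_inl {φ ψ : Formula (PName P)} {p : P} (h : Forces p φ) : Forces p (φ.or ψ) :=
  fun q hq => ⟨q, le_rfl, .inl (h.mono hq)⟩

theorem Forces.or_inr {φ ψ : Formula (PName P)} {p : P} (h : Forces p ψ) : Forces p (φ.or ψ) :=
  fun q hq => ⟨q, le_rfl, .inr (h.mono hq)⟩

/-- A disjunction is decided only on a dense set, so case analysis ends with `Forces.of_dense`; the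
same holds for existential quantifiers. -/
theorem Forces.or_elim {φ ψ χ : Formula (PName P)} {p : P} (h : Forces p (φ.or ψ))
    (h₁ : ∀ q ≤ p, Forces q φ → Forces q χ) (h₂ : ∀ q ≤ p, Forces q ψ → Forces q χ) :
    Forces p χ := by
  refine .of_dense fun q hq => ?_
  obtain ⟨r, hr, H | H⟩ := h q hq
  · exact ⟨r, hr, h₁ r (hr.trans hq) H⟩
  · exact ⟨r, hr, h₂ r (hr.trans hq) H⟩

theorem Forces.ex_intro {φ : PName P → Formula (PName P)} {p : P} (σ : PName P)
    (h : Forces p (φ σ)) : Forces p (.ex φ) :=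
  fun q hq => ⟨q, le_rfl, σ, h.mono hq⟩

theorem Forces.ex_elim {φ : PName P → Formula (PName P)} {χ : Formula (PName P)} {p : P}
    (h : Forces p (.ex φ)) (H : ∀ q ≤ p, ∀ σ, Forces q (φ σ) → Forces q χ) : Forces p χ := by
  refine .of_dense fun q hq => ?_
  obtain ⟨r, hr, σ, hσ⟩ := h q hq
  exact ⟨r, hr, H r (hr.trans hq) σ hσ⟩

theorem Forces.mp {φ ψ : Formula (PName P)} {p : P} (h : Forces p (φ.imp ψ)) (hφ : Forces p φ) :
    Forces p ψ :=
  h p le_rfl hφ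

/-! ### Equality -/

theorem forcesEq_refl (σ : PName P) (p : P) : forcesEq σ σ p := by
  induction σ generalizing p with
  | mk ι A c ih =>
    exact ⟨fun i q _ hi => ⟨q, le_rfl, i, hi, ih i q⟩, fun i q _ hi => ⟨q, le_rfl, i, hi, ih i q⟩⟩

theorem forcesEq_symm {σ τ : PName P} {p : P} (h : forcesEq σ τ p) : forcesEq τ σ p := by
  induction σ generalizing τ p with
  | mk ι A c ih =>
    cases τ
    refine ⟨fun j q hq hj => ?_, fun i q hq hi => ?_⟩
    · obtain ⟨r, hr, i, hi, H⟩ := h.2 j q hq hj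
      exact ⟨r, hr, i, hi, ih i H⟩
    · obtain ⟨r, hr, j, hj, H⟩ := h.1 i q hq hi
      exact ⟨r, hr, j, hj, ih i H⟩

theorem forcesEq_trans {σ τ υ : PName P} {p : P} (h : forcesEq σ τ p) (h' : forcesEq τ υ p) :
    forcesEq σ υ p := by
  induction σ generalizing τ υ p with
  | mk ι A c ih =>
    cases τ; cases υ
    refine ⟨fun i q hq hi => ?_, fun k q hq hk => ?_⟩
    · obtain ⟨r, hr, j, hj, H⟩ := h.1 i q hq hi
      obtain ⟨s, hs, k, hk, H'⟩ := h'.1 j r (hr.trans hq) hj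
      exact ⟨s, hs.trans hr, k, hk, ih i (forcesEq_mono H hs) H'⟩
    · obtain ⟨r, hr, j, hj, H⟩ := h'.2 k q hq hk
      obtain ⟨s, hs, i, hi, H'⟩ := h.2 j r (hr.trans hq) hj
      exact ⟨s, hs.trans hr, i, hi, ih i H' (forcesEq_mono H hs)⟩

theorem Forces.rfl' {σ : PName P} {p : P} : Forces p (.eq σ σ) := forcesEq_refl σ p

theorem Forces.symm {σ τ : PName P} {p : P} (h : Forces p (.eq σ τ)) : Forces p (.eq τ σ) :=
  forcesEq_symm h

theorem Forces.trans {σ τ υ : PName P} {p : P} (h : Forces p (.eq σ τ))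
    (h' : Forces p (.eq τ υ)) : Forces p (.eq σ υ) :=
  forcesEq_trans h h'

theorem Forces.mem_congr_left {σ σ' τ : PName P} {p : P} (h : Forces p (.mem σ τ))
    (e : Forces p (.eq σ σ')) : Forces p (.mem σ' τ) := by
  cases τ
  intro q hq
  obtain ⟨r, hr, j, hj, H⟩ := h q hq
  exact ⟨r, hr, j, hj, forcesEq_trans (forcesEq_symm (forcesEq_mono e (hr.trans hq))) H⟩

theorem Forces.mem_congr_right {σ τ τ' : PName P} {p : P} (h : Forces p (.mem σ τ))
    (e : Forces p (.eq τ τ')) : Forces p (.mem σ τ') := by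
  cases τ; cases τ'
  intro q hq
  obtain ⟨r, hr, i, hi, H⟩ := h q hq
  obtain ⟨s, hs, j, hj, H'⟩ := e.1 i r (hr.trans hq) hi
  exact ⟨s, hs.trans hr, j, hj, forcesEq_trans (forcesEq_mono H hs) H'⟩

/-! ### Substitution of equals -/

/-- `p` forces `φ` and `ψ` to be equivalent. -/
def EquivAt (p : P) (φ ψ : Formula (PName P)) : Prop := ∀ q ≤ p, Forces q φ ↔ Forces q ψ

namespace EquivAt

variable {p : P} {φ φ' ψ ψ' : Formula (PName P)}

theorem iff (h : EquivAt p φ ψ) : Forces p φ ↔ Forces p ψ := h p le_rfl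

theorem and (h : EquivAt p φ φ') (h' : EquivAt p ψ ψ') : EquivAt p (φ.and ψ) (φ'.and ψ') :=
  fun q hq => and_congr (h q hq) (h' q hq)

theorem or (h : EquivAt p φ φ') (h' : EquivAt p ψ ψ') : EquivAt p (φ.or ψ) (φ'.or ψ') :=
  fun _ hq => forall₂_congr fun _ hr => exists_congr fun s => and_congr_right fun hs =>
    or_congr (h s (hs.trans (hr.trans hq))) (h' s (hs.trans (hr.trans hq)))

theorem imp (h : EquivAt p φ φ') (h' : EquivAt p ψ ψ') : EquivAt p (φ.imp ψ) (φ'.imp ψ') :=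
  fun _ hq => forall₂_congr fun r hr => imp_congr (h r (hr.trans hq)) (h' r (hr.trans hq))

theorem all {φ φ' : PName P → Formula (PName P)} (h : ∀ σ, EquivAt p (φ σ) (φ' σ)) :
    EquivAt p (.all φ) (.all φ') :=
  fun q hq => forall_congr' fun σ => h σ q hq

theorem ex {φ φ' : PName P → Formula (PName P)} (h : ∀ σ, EquivAt p (φ σ) (φ' σ)) :
    EquivAt p (.ex φ) (.ex φ') :=
  fun _ hq => forall₂_congr fun _ hr => exists_congr fun s => and_congr_right fun hs =>
    exists_congr fun σ => h σ s (hs.trans (hr.trans hq))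

variable {σ σ' τ τ' υ υ' : PName P}

theorem mem (h : Forces p (.eq σ σ')) (h' : Forces p (.eq τ τ')) :
    EquivAt p (.mem σ τ) (.mem σ' τ') :=
  fun _ hq => ⟨fun H => (H.mem_congr_left (h.mono hq)).mem_congr_right (h'.mono hq),
    fun H => (H.mem_congr_left (h.mono hq).symm).mem_congr_right (h'.mono hq).symm⟩

theorem eq (h : Forces p (.eq σ σ')) (h' : Forces p (.eq τ τ')) :
    EquivAt p (.eq σ τ) (.eq σ' τ') :=
  fun _ hq => ⟨fun H => ((h.mono hq).symm.trans H).trans (h'.mono hq),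
    fun H => ((h.mono hq).trans H).trans (h'.mono hq).symm⟩

/-- A quantifier in `Formula` takes an arbitrary family of instances, which need not respect forced
equality. There is thus no general substitution principle, and each predicate gets its own
congruence. -/
theorem isPair (h : Forces p (.eq σ σ')) (h' : Forces p (.eq τ τ')) (h'' : Forces p (.eq υ υ')) :
    EquivAt p (isPair σ τ υ) (isPair σ' τ' υ') :=
  have H₁ (w : PName P) := mem (Forces.rfl' (σ := w)) h
  have H₂ (w : PName P) := or (eq (Forces.rfl' (σ := w)) h') (eq (Forces.rfl' (σ := w)) h'')
  all fun w => and (imp (H₁ w) (H₂ w)) (imp (H₂ w) (H₁ w))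

theorem isOrderedPair (h : Forces p (.eq σ σ')) (h' : Forces p (.eq τ τ'))
    (h'' : Forces p (.eq υ υ')) : EquivAt p (isOrderedPair σ τ υ) (isOrderedPair σ' τ' υ') :=
  ex fun _ => ex fun _ => and (isPair .rfl' h' h') (and (isPair .rfl' h' h'') (isPair h .rfl' .rfl'))

theorem maps (h : Forces p (.eq σ σ')) (h' : Forces p (.eq τ τ')) (h'' : Forces p (.eq υ υ')) :
    EquivAt p (maps σ τ υ) (maps σ' τ' υ') :=
  ex fun _ => and (mem .rfl' h) (isOrderedPair .rfl' h' h'')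

theorem isFunction (h : Forces p (.eq σ σ')) :
    EquivAt p (isFunction σ τ υ) (isFunction σ' τ υ) :=
  and (all fun _ => imp (mem .rfl' h) fun _ _ => Iff.rfl)
    (and (all fun _ => imp (fun _ _ => Iff.rfl) (ex fun _ => and (fun _ _ => Iff.rfl)
      (maps h .rfl' .rfl')))
      (all fun _ => all fun _ => all fun _ => imp (and (maps h .rfl' .rfl') (maps h .rfl' .rfl'))
        fun _ _ => Iff.rfl))

end EquivAt

/-! ### Pairs -/

theorem Forces.mem_isPair {z x y w : PName P} {p : P} (h : Forces p (isPair z x y))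
    (hw : Forces p (.mem w z)) : Forces p (.or (.eq w x) (.eq w y)) :=
  (h w).1.mp hw

theorem Forces.left_mem_isPair {z x y : PName P} {p : P} (h : Forces p (isPair z x y)) :
    Forces p (.mem x z) :=
  (h x).2.mp (.or_inl .rfl')

theorem Forces.right_mem_isPair {z x y : PName P} {p : P} (h : Forces p (isPair z x y)) :
    Forces p (.mem y z) :=
  (h y).2.mp (.or_inr .rfl')

theorem Forces.eq_of_mem_singleton {z x w : PName P} {p : P} (h : Forces p (isPair z x x))
    (hw : Forces p (.mem w z)) : Forces p (.eq w x) :=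
  (h.mem_isPair hw).or_elim (fun _ _ h => h) (fun _ _ h => h)

theorem Forces.isPair_right_unique {z x y y' : PName P} {p : P} (h : Forces p (isPair z x y))
    (h' : Forces p (isPair z x y')) : Forces p (.eq y y') :=
  (h'.mem_isPair h.right_mem_isPair).or_elim
    (fun _ hq e => ((h.mono hq).mem_isPair (h'.mono hq).right_mem_isPair).or_elim
      (fun _ hr e' => (e.mono hr).trans e'.symm) (fun _ _ e' => e'.symm))
    (fun _ _ e => e)

theorem Forces.isOrderedPair_unique {z x y x' y' : PName P} {p : P}
    (h : Forces p (isOrderedPair z x y)) (h' : Forces p (isOrderedPair z x' y')) :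
    Forces p (.and (.eq x x') (.eq y y')) := by
  refine h.ex_elim fun q hq s h => h.ex_elim fun q₁ hq₁ t h => ?_
  refine (h'.mono (hq₁.trans hq)).ex_elim fun q₂ hq₂ s' h' => h'.ex_elim fun q₃ hq₃ t' h' => ?_
  replace h := h.mono (hq₃.trans hq₂)
  clear hq₃ hq₂ hq₁ hq
  have hx : Forces q₃ (.eq x x') := by
    refine (h'.2.2.mem_isPair h.2.2.left_mem_isPair).or_elim (fun r hr e => ?_) (fun r hr e => ?_)
    · exact (h'.mono hr).1.eq_of_mem_singleton ((h.mono hr).1.left_mem_isPair.mem_congr_right e)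
    · exact ((h.mono hr).1.eq_of_mem_singleton
        ((h'.mono hr).2.1.left_mem_isPair.mem_congr_right e.symm)).symm
  refine ⟨hx, ?_⟩
  have key (r : P) (hr : r ≤ q₃) (e : Forces r (.eq t t')) : Forces r (.eq y y') :=
    (h.2.1.mono hr).isPair_right_unique
      ((EquivAt.isPair e (hx.mono hr) .rfl').iff.2 (h'.2.1.mono hr))
  refine (h'.2.2.mem_isPair h.2.2.right_mem_isPair).or_elim (fun r hr e => ?_) key
  refine ((h.2.2.mem_isPair h'.2.2.right_mem_isPair).mono hr).or_elim (fun r' hr' e' => ?_)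
    fun r' hr' e' => key r' (hr'.trans hr) e'.symm
  -- Degenerate case: t = s' and t' = s are singletons, so y = x' and y' = x, and x = x' closes the
  -- gap.
  have e₁ := (h'.mono (hr'.trans hr)).1.eq_of_mem_singleton
    ((h.mono (hr'.trans hr)).2.1.right_mem_isPair.mem_congr_right (e.mono hr'))
  have e₂ := (h.mono (hr'.trans hr)).1.eq_of_mem_singleton
    ((h'.mono (hr'.trans hr)).2.1.right_mem_isPair.mem_congr_right e')
  exact (e₁.trans (hx.mono (hr'.trans hr)).symm).trans e₂.symm

/-! ### Names for indexed sets, ordered pairs and graphs -/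

theorem forces_mem_setName {ι : Type u} (A : ι → PName P) (i : ι) (p : P) :
    Forces p (.mem (A i) (setName A)) :=
  fun q _ => ⟨q, le_rfl, (i, q), le_rfl, forcesEq_refl _ _⟩

theorem Forces.exists_of_mem_setName {ι : Type u} {A : ι → PName P} {σ : PName P} {p : P}
    (h : Forces p (.mem σ (setName A))) : ∃ r ≤ p, ∃ i, Forces r (.eq σ (A i)) := by
  obtain ⟨r, hr, j, -, H⟩ := h p le_rfl
  exact ⟨r, hr, j.1, H⟩

theorem Forces.mem_setName_elim {ι : Type u} {A : ι → PName P} {σ : PName P} {p : P}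
    {χ : Formula (PName P)} (h : Forces p (.mem σ (setName A)))
    (H : ∀ q ≤ p, ∀ i, Forces q (.eq σ (A i)) → Forces q χ) : Forces p χ := by
  refine .of_dense fun q hq => ?_
  obtain ⟨r, hr, i, e⟩ := (h.mono hq).exists_of_mem_setName
  exact ⟨r, hr, H r (hr.trans hq) i e⟩

/-- The name of the unordered pair. -/
def pairName (σ τ : PName P) : PName P := setName fun b : ULift Bool => cond b.down σ τ

theorem forces_isPair_pairName (σ τ : PName P) (p : P) : Forces p (isPair (pairName σ τ) σ τ) := by
  intro w
  refine ⟨fun q hq h => h.mem_setName_elim ?_, fun q hq h => h.or_elim ?_ ?_⟩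
  · rintro r hr ⟨_ | _⟩ e
    · exact .or_inr e
    · exact .or_inl e
  · exact fun r _ e => (forces_mem_setName _ (ULift.up true) r).mem_congr_left e.symm
  · exact fun r _ e => (forces_mem_setName _ (ULift.up false) r).mem_congr_left e.symm

/-- The name of the Kuratowski ordered pair. -/
def orderedPairName (σ τ : PName P) : PName P := pairName (pairName σ σ) (pairName σ τ)

theorem forces_isOrderedPair_orderedPairName (σ τ : PName P) (p : P) :
    Forces p (isOrderedPair (orderedPairName σ τ) σ τ) :=
  .ex_intro (pairName σ σ) <| .ex_intro (pairName σ τ) <|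
    ⟨forces_isPair_pairName _ _ _, forces_isPair_pairName _ _ _, forces_isPair_pairName _ _ _⟩

/-- The name of the function that sends `A i` to `B i`. -/
def graphName {ι : Type u} (A B : ι → PName P) : PName P :=
  setName fun i => orderedPairName (A i) (B i)

theorem forces_maps_graphName {ι : Type u} (A B : ι → PName P) (i : ι) (p : P) :
    Forces p (maps (graphName A B) (A i) (B i)) :=
  .ex_intro (orderedPairName (A i) (B i))
    ⟨forces_mem_setName (fun i => orderedPairName (A i) (B i)) i p,
      forces_isOrderedPair_orderedPairName _ _ _⟩

theorem Forces.maps_graphName_elim {ι : Type u} {A B : ι → PName P} {σ τ : PName P} {p : P}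
    {χ : Formula (PName P)} (h : Forces p (maps (graphName A B) σ τ))
    (H : ∀ q ≤ p, ∀ i, Forces q (.eq σ (A i)) → Forces q (.eq τ (B i)) → Forces q χ) :
    Forces p χ := by
  refine h.ex_elim fun q hq z hz => hz.1.mem_setName_elim fun r hr i e => ?_
  have h₁ := (EquivAt.isOrderedPair e .rfl' .rfl').iff.1 (hz.2.mono hr)
  have h₂ := h₁.isOrderedPair_unique (forces_isOrderedPair_orderedPairName (A i) (B i) r)
  exact H r (hr.trans hq) i h₂.1 h₂.2

/-- The members of the family are forced to be distinct. -/
def Discrete {ι : Type u} (A : ι → PName P) : Prop := ∀ p i j, Forces p (.eq (A i) (A j)) → i = j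

theorem Forces.maps_graphName_apply {ι : Type u} {A B : ι → PName P} (hA : Discrete A) {i : ι}
    {τ : PName P} {p : P} (h : Forces p (maps (graphName A B) (A i) τ)) :
    Forces p (.eq τ (B i)) :=
  h.maps_graphName_elim fun q _ j h₁ h₂ => by rwa [hA q i j h₁]

theorem forces_isFunction_graphName {ι κ : Type u} {A : ι → PName P} (hA : Discrete A)
    (B : κ → PName P) (f : ι → κ) (p : P) :
    Forces p (isFunction (graphName A fun i => B (f i)) (setName A) (setName B)) := by
  refine ⟨fun z q _ hz => hz.mem_setName_elim fun r _ i e => ?_, fun x q _ hx =>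
    hx.mem_setName_elim fun r _ i e => ?_, fun x y y' q _ h => ?_⟩
  · exact .ex_intro (A i) ⟨forces_mem_setName _ _ _, .ex_intro (B (f i)) ⟨forces_mem_setName _ _ _,
      (EquivAt.isOrderedPair e .rfl' .rfl').iff.2 (forces_isOrderedPair_orderedPairName _ _ _)⟩⟩
  · exact .ex_intro (B (f i)) ⟨forces_mem_setName _ _ _,
      (EquivAt.maps .rfl' e .rfl').iff.2 (forces_maps_graphName A (fun i => B (f i)) i r)⟩
  · refine h.1.maps_graphName_elim fun r hr i h₁ h₂ => ?_
    exact h₂.trans (((EquivAt.maps .rfl' h₁ .rfl').iff.1 (h.2.mono hr)).maps_graphName_apply hA).symm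

theorem forces_isBijection_graphName {ι κ : Type u} {A : ι → PName P} (hA : Discrete A)
    {B : κ → PName P} (hB : Discrete B) (e : ι ≃ κ) (p : P) :
    Forces p (isBijection (graphName A fun i => B (e i)) (setName A) (setName B)) := by
  refine ⟨forces_isFunction_graphName hA B e p, fun x x' y q _ h => ?_,
    fun y q _ hy => hy.mem_setName_elim fun r _ j h => ?_⟩
  · refine h.1.maps_graphName_elim fun r hr i h₁ h₂ => (h.2.mono hr).maps_graphName_elim
      fun s hs j h₁' h₂' => ?_
    obtain rfl := e.injective (hB s _ _ ((h₂.mono hs).symm.trans h₂'))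
    exact (h₁.mono hs).trans h₁'.symm
  · refine .ex_intro (A (e.symm j)) ⟨forces_mem_setName _ _ _, ?_⟩
    have := forces_maps_graphName A (fun i => B (e i)) (e.symm j) r
    rw [e.apply_symm_apply] at this
    exact (EquivAt.maps .rfl' .rfl' h).iff.2 this

/-! ### Functions in the extension -/

theorem Forces.maps_unique {f a b x y y' : PName P} {p : P} (hf : Forces p (isFunction f a b))
    (h : Forces p (maps f x y)) (h' : Forces p (maps f x y')) : Forces p (.eq y y') :=
  (hf.2.2 x y y').mp ⟨h, h'⟩

/-- A stronger condition decides which of the listed names is the value. -/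
theorem Forces.exists_maps_setName {f a x : PName P} {κ : Type u} {B : κ → PName P} {p : P}
    (hf : Forces p (isFunction f a (setName B))) (hx : Forces p (.mem x a)) :
    ∃ q ≤ p, ∃ j, Forces q (maps f x (B j)) := by
  obtain ⟨q, hq, y, hy, h⟩ := (hf.2.1 x).mp hx p le_rfl
  obtain ⟨r, hr, j, e⟩ := hy.exists_of_mem_setName
  exact ⟨r, hr.trans hq, j, (EquivAt.maps .rfl' .rfl' e).iff.1 (h.mono hr)⟩

/-! ### Ordinals -/

theorem forces_ordName_mem {a b : Ordinal.{u}} (h : a < b) (p : P) :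
    Forces p (.mem (ordName P a) (ordName P b)) := by
  rw [ordName_eq b]
  simpa using forces_mem_setName (fun a : b.ToType => ordName P (a.toOrd : Ordinal.{u}))
    (Ordinal.ToType.mk ⟨a, h⟩) p

theorem Forces.mem_ordName_elim {b : Ordinal.{u}} {σ : PName P} {p : P} {χ : Formula (PName P)}
    (h : Forces p (.mem σ (ordName P b)))
    (H : ∀ q ≤ p, ∀ a < b, Forces q (.eq σ (ordName P a)) → Forces q χ) : Forces p χ := by
  rw [ordName_eq] at h
  exact h.mem_setName_elim fun q hq i e => H q hq _ i.toOrd.2 e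

theorem Forces.exists_of_mem_ordName {b : Ordinal.{u}} {σ : PName P} {p : P}
    (h : Forces p (.mem σ (ordName P b))) : ∃ q ≤ p, ∃ a < b, Forces q (.eq σ (ordName P a)) := by
  rw [ordName_eq] at h
  obtain ⟨q, hq, i, e⟩ := h.exists_of_mem_setName
  exact ⟨q, hq, _, i.toOrd.2, e⟩

theorem Forces.not_lt_of_ordName_eq {a b : Ordinal.{u}} {p : P}
    (h : Forces p (.eq (ordName P a) (ordName P b))) : ¬ a < b := by
  induction b using WellFoundedLT.induction generalizing a p with
  | ind b ih =>
    intro hab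
    -- From a ∈ b = a, some extension forces a = c with c < a, a counterexample with the smaller
    -- bound a.
    obtain ⟨q, hq, c, hc, e⟩ :=
      ((forces_ordName_mem hab p).mem_congr_right h.symm).exists_of_mem_ordName
    exact ih a hab e.symm hc

theorem Forces.ordName_inj {a b : Ordinal.{u}} {p : P}
    (h : Forces p (.eq (ordName P a) (ordName P b))) : a = b :=
  le_antisymm (not_lt.1 h.symm.not_lt_of_ordName_eq) (not_lt.1 h.not_lt_of_ordName_eq)

theorem Forces.lt_of_ordName_mem {a b : Ordinal.{u}} {p : P}
    (h : Forces p (.mem (ordName P a) (ordName P b))) : a < b := by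
  obtain ⟨q, hq, c, hc, e⟩ := h.exists_of_mem_ordName
  rwa [e.ordName_inj]

theorem discrete_ordName (o : Ordinal.{u}) :
    Discrete fun a : o.ToType => ordName P (a.toOrd : Ordinal.{u}) :=
  fun _ _ _ h => Ordinal.ToType.mk.symm.injective (Subtype.ext h.ordName_inj)

theorem Forces.le_of_ordLe {a b : Ordinal.{u}} {p : P}
    (h : Forces p (ordLe (ordName P a) (ordName P b))) : a ≤ b := by
  obtain ⟨q, hq, h | h⟩ := h p le_rfl
  · exact h.lt_of_ordName_mem.le
  · exact h.ordName_inj.le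

theorem forces_ordLe {a b : Ordinal.{u}} (h : a ≤ b) (p : P) :
    Forces p (ordLe (ordName P a) (ordName P b)) := by
  obtain h | rfl := h.lt_or_eq
  · exact .or_inl (forces_ordName_mem h p)
  · exact .or_inr .rfl'

theorem Forces.ordLe_congr {σ σ' τ τ' : PName P} {p : P} (h : Forces p (ordLe σ τ))
    (e : Forces p (.eq σ σ')) (e' : Forces p (.eq τ τ')) : Forces p (ordLe σ' τ') :=
  (EquivAt.or (.mem e e') (.eq e e')).iff.1 h

theorem forces_isTransitive_ordName (o : Ordinal.{u}) (p : P) :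
    Forces p (isTransitive (ordName P o)) := by
  refine fun x q _ hx => hx.mem_ordName_elim fun r _ a ha e y s hs hy => ?_
  refine (hy.mem_congr_right (e.mono hs)).mem_ordName_elim fun t _ b hb e' => ?_
  exact (forces_ordName_mem (hb.trans ha) t).mem_congr_left e'.symm

theorem forces_isOrdinal_ordName (o : Ordinal.{u}) (p : P) :
    Forces p (isOrdinal (ordName P o)) := by
  refine ⟨forces_isTransitive_ordName o p, fun x q _ hx => hx.mem_ordName_elim fun r _ a _ e => ?_⟩
  exact (EquivAt.all fun _ => .imp (.mem .rfl' e) (.all fun _ => .imp (fun _ _ => Iff.rfl)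
    (.mem .rfl' e))).iff.2 (forces_isTransitive_ordName a r)

end Forcing

/-! ### Ground-model functions and the chain condition -/

section Bounding

variable {κ : Cardinal.{u}} {P : Type u} [Preorder P]

/-- The canonical name of a ground-model function from `κ` to `κ`. -/
noncomputable def funName (P : Type u) (f : Baire κ) : PName P :=
  graphName (fun a : κ.ord.ToType => ordName P (a.toOrd : Ordinal.{u}))
    fun a => ordName P ((f a).toOrd : Ordinal.{u})

theorem forces_isFunction_funName (f : Baire κ) (p : P) :
    Forces p (isFunction (funName P f) (ordName P κ.ord) (ordName P κ.ord)) := by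
  rw [ordName_eq]
  exact forces_isFunction_graphName (discrete_ordName _)
    (fun a : κ.ord.ToType => ordName P (a.toOrd : Ordinal.{u})) f p

theorem forces_maps_funName (f : Baire κ) (a : κ.ord.ToType) (p : P) :
    Forces p (maps (funName P f) (ordName P (a.toOrd : Ordinal.{u}))
      (ordName P ((f a).toOrd : Ordinal.{u}))) :=
  forces_maps_graphName (fun a : κ.ord.ToType => ordName P (a.toOrd : Ordinal.{u}))
    (fun a => ordName P ((f a).toOrd : Ordinal.{u})) a p

theorem Forces.eq_of_maps_funName {f : Baire κ} {a : κ.ord.ToType} {σ : PName P} {p : P}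
    (h : Forces p (maps (funName P f) (ordName P (a.toOrd : Ordinal.{u})) σ)) :
    Forces p (.eq σ (ordName P ((f a).toOrd : Ordinal.{u}))) :=
  Forces.maps_graphName_apply (discrete_ordName κ.ord) (i := a) h

/-- Makes the names of a ground-model family discrete, so that its enumeration in `V` names a
bijection. -/
theorem funName_inj {f g : Baire κ} {p : P} (h : Forces p (.eq (funName P f) (funName P g))) :
    f = g := by
  funext a
  refine discrete_ordName κ.ord p _ _ (Forces.eq_of_maps_funName ?_)
  exact (EquivAt.maps h .rfl' .rfl').iff.1 (forces_maps_funName f a p)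

theorem Forces.exists_maps_ordName {f a x : PName P} {p : P}
    (hf : Forces p (isFunction f a (ordName P κ.ord))) (hx : Forces p (.mem x a)) :
    ∃ q ≤ p, ∃ j : κ.ord.ToType, Forces q (maps f x (ordName P (j.toOrd : Ordinal.{u}))) := by
  rw [ordName_eq] at hf
  exact hf.exists_maps_setName hx

/-- If `P` is `κ`-cc with `κ` regular, a value below `κ` that is decided by conditions, with
compatible conditions deciding it the same way, has only boundedly many possibilities. -/
theorem ChainCondition.exists_bound (hP : ChainCondition κ P) (hκ : κ.IsRegular)
    (R : κ.ord.ToType → P → Prop)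
    (hR : ∀ {b b' p p' q}, R b p → R b' p' → q ≤ p → q ≤ p' → b = b') :
    ∃ c, ∀ b p, R b p → b ≤ c := by
  -- One deciding condition for each possible value; these conditions form the antichain.
  choose c hc using fun b : {b // ∃ p, R b p} => b.2
  have hinj : Function.Injective c := fun b b' h =>
    Subtype.ext (hR (hc b) (hc b') le_rfl h.le)
  have hanti : IsStrongAntichain (· ≥ ·) (Set.range c) := by
    rintro _ ⟨b, rfl⟩ _ ⟨b', rfl⟩ hne q
    by_contra! H
    exact hne (congrArg c (Subtype.ext (hR (hc b) (hc b') H.1 H.2)))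
  -- Regularity enters here: fewer than κ values are fewer than the cofinality, hence not cofinal.
  have hlt : Cardinal.mk {b | ∃ p, R b p} < Order.cof κ.ord.ToType := by
    have := hP _ hanti
    rw [Cardinal.mk_range_eq _ hinj] at this
    refine this.trans_eq ?_
    rw [← Ordinal.cof_type, Ordinal.type_toType, hκ.cof_ord]
  have hb : ¬ IsCofinal {b | ∃ p, R b p} := fun h => (Order.cof_le h).not_gt hlt
  simp only [IsCofinal, not_forall, not_exists, not_and, not_le] at hb
  obtain ⟨x, hx⟩ := hb
  exact ⟨x, fun b p h => (hx b ⟨p, h⟩).le⟩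

/-- A `κ`-cc poset is `κ^κ`-bounding. -/
theorem ChainCondition.exists_bounding (hP : ChainCondition κ P) (hκ : κ.IsRegular) (x : PName P) :
    ∃ z : Baire κ, ∀ (a : κ.ord.ToType) (p : P) (y : PName P),
      Forces p (isFunction x (ordName P κ.ord) (ordName P κ.ord)) →
      Forces p (maps x (ordName P (a.toOrd : Ordinal.{u})) y) →
      Forces p (ordLe y (ordName P ((z a).toOrd : Ordinal.{u}))) := by
  -- Compatible conditions agree because a common extension forces x to be single-valued.
  choose z hz using fun a : κ.ord.ToType => hP.exists_bound hκ
    (fun b p => Forces p (isFunction x (ordName P κ.ord) (ordName P κ.ord)) ∧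
      Forces p (maps x (ordName P (a.toOrd : Ordinal.{u})) (ordName P (b.toOrd : Ordinal.{u}))))
    (fun {b b' p p' q} h h' hq hq' => discrete_ordName κ.ord q _ _
      ((h.1.mono hq).maps_unique (h.2.mono hq) (h'.2.mono hq')))
  refine ⟨z, fun a p y hx hy => .of_dense fun q hq => ?_⟩
  obtain ⟨r, hr, b, hb⟩ := (hx.mono hq).exists_maps_ordName (forces_ordName_mem (Set.mem_Iio.1 a.toOrd.2) q)
  have hrp := hr.trans hq
  refine ⟨r, hr, (forces_ordLe ?_ r).ordLe_congr ((hx.mono hrp).maps_unique hb (hy.mono hrp)) .rfl'⟩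
  exact Subtype.coe_le_coe.2 (Ordinal.ToType.mk.symm.monotone (hz a b r ⟨hx.mono hrp, hb⟩))

/-! ### The dominating number of the extension -/

theorem exists_isDominating (hκ : κ.IsRegular) :
    ∃ D : Set (Baire κ), IsDominating D ∧ Cardinal.mk D = dominatingNumber κ := by
  have : Nonempty κ.ord.ToType := by
    rw [Ordinal.nonempty_toType_iff]
    simpa using hκ.ne_zero
  exact csInf_mem (s := {c | ∃ D : Set (Baire κ), IsDominating D ∧ Cardinal.mk D = c})
    ⟨_, Set.univ, fun g => ⟨g, trivial, Classical.arbitrary _, fun _ _ => le_rfl⟩, rfl⟩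

/-- A family dominating in the ground model stays dominating. -/
theorem ChainCondition.forces_isDominating (hP : ChainCondition κ P) (hκ : κ.IsRegular)
    {D : Set (Baire κ)} (hD : IsDominating D) (p : P) :
    Forces p (isDominating (ordName P κ.ord) (setName fun f : D => funName P f.1)) := by
  refine ⟨fun f q _ hf => hf.mem_setName_elim fun r _ i e =>
    (EquivAt.isFunction e).iff.2 (forces_isFunction_funName i.1 r), fun g q _ hg => ?_⟩
  obtain ⟨z, hz⟩ := hP.exists_bounding hκ g
  -- The witnesses f and a for z also work for g, since g ≤ z everywhere.
  obtain ⟨f, hf, a, ha⟩ := hD z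
  refine .ex_intro (funName P f) ⟨forces_mem_setName (fun f : D => funName P f.1) ⟨f, hf⟩ q, ?_⟩
  refine .ex_intro (ordName P (a.toOrd : Ordinal.{u})) ⟨forces_ordName_mem (Set.mem_Iio.1 a.toOrd.2) q, ?_⟩
  intro x r hr hx
  rw [ordName_eq] at hx
  refine hx.mem_setName_elim fun s hs b e t ht hab y w t' ht' h => ?_
  have hlt := (hab.mem_congr_right (e.mono ht)).lt_of_ordName_mem
  have e' := e.mono (ht'.trans ht)
  have hy := hz b t' y (hg.mono (((ht'.trans ht).trans hs).trans hr))
    ((EquivAt.maps .rfl' e' .rfl').iff.1 h.1)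
  have hw := ((EquivAt.maps .rfl' e' .rfl').iff.1 h.2).eq_of_maps_funName
  have hle : ((z b).toOrd : Ordinal.{u}) ≤ ((f b).toOrd : Ordinal.{u}) :=
    Ordinal.ToType.mk.symm.monotone (ha b (Ordinal.ToType.mk.symm.lt_iff_lt.1 hlt))
  refine hy.or_elim (fun u _ hm => ?_) fun u hu he => ?_
  · refine .or_inl (hm.mem_ordName_elim fun v hv c hc ec => ?_)
    exact ((forces_ordName_mem (hc.trans_le hle) v).mem_congr_left ec.symm).mem_congr_right
      (hw.mono (hv.trans ‹_›)).symm
  · exact (forces_ordLe hle u).ordLe_congr he.symm (hw.mono hu).symm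

/-- No dominating family of the extension is enumerated by an ordinal below the ground-model
dominating number. -/
theorem ChainCondition.not_forces_isBijection (hP : ChainCondition κ P) (hκ : κ.IsRegular)
    {o : Ordinal.{u}} (ho : o < (dominatingNumber κ).ord) {h n D : PName P} {p : P}
    (hD : Forces p (isDominating (ordName P κ.ord) D)) (hn : Forces p (.eq n (ordName P o)))
    (hh : Forces p (isBijection h n D)) : False := by
  -- z i bounds every possible value of the i-th enumerated function. That function is quantified
  -- inside the relation because different conditions may give it different names.
  choose z hz using fun (i : o.ToType) (a : κ.ord.ToType) => hP.exists_bound hκ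
    (fun b q => q ≤ p ∧ ∃ f, Forces q (isFunction f (ordName P κ.ord) (ordName P κ.ord)) ∧
      Forces q (maps h (ordName P (i.toOrd : Ordinal.{u})) f) ∧
      Forces q (maps f (ordName P (a.toOrd : Ordinal.{u})) (ordName P (b.toOrd : Ordinal.{u}))))
    (by
      rintro b b' q q' r ⟨hqp, f, hf, hhf, hfb⟩ ⟨-, f', -, hhf', hfb'⟩ hq hq'
      have e := (hh.1.mono (hq.trans hqp)).maps_unique (hhf.mono hq) (hhf'.mono hq')
      exact discrete_ordName κ.ord r _ _ ((hf.mono hq).maps_unique (hfb.mono hq)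
        ((EquivAt.maps e .rfl' .rfl').iff.2 (hfb'.mono hq'))))
  -- For g in `V`, extend p to decide the index i of a function f dominating g, and the point a
  -- beyond which it does; then g ≤ f ≤ z i beyond a.
  have hdom : IsDominating (Set.range z) := by
    intro g
    obtain ⟨q, hq, f, hfD, hgf⟩ :=
      ((hD.2 (funName P g)).mp (forces_isFunction_funName g p)) p le_rfl
    obtain ⟨q₁, hq₁, x, hx, hxf⟩ := (hh.2.2 f).mono hq |>.mp hfD q le_rfl
    have hx' := hx.mem_congr_right (hn.mono (hq₁.trans hq))
    rw [ordName_eq] at hx'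
    obtain ⟨q₂, hq₂, i, ei⟩ := hx'.exists_of_mem_setName
    obtain ⟨q₃, hq₃, a', ha', hgf'⟩ := hgf q₂ (hq₂.trans hq₁)
    rw [ordName_eq] at ha'
    obtain ⟨q₄, hq₄, a, ea⟩ := ha'.exists_of_mem_setName
    have hq₄₁ := (hq₄.trans hq₃).trans hq₂
    have hq₄q := hq₄₁.trans hq₁
    have hf := ((hD.1 f).mono hq |>.mp hfD).mono hq₄q
    refine ⟨z i, ⟨i, rfl⟩, a, fun b hab => ?_⟩
    have hb := forces_ordName_mem (P := P) (Set.mem_Iio.1 b.toOrd.2) q₄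
    -- The condition deciding f(b) depends on b, which is harmless: the resulting inequality g b ≤ z
    -- i b mentions no condition.
    obtain ⟨q₅, hq₅, c, hc⟩ := hf.exists_maps_ordName hb
    have hab' : Forces q₅ (.mem a' (ordName P (b.toOrd : Ordinal.{u}))) :=
      (forces_ordName_mem (Ordinal.ToType.mk.symm.strictMono hab) q₅).mem_congr_left
        (ea.mono hq₅).symm
    have hle := ((((hgf' _).mono (hq₅.trans hq₄)).mp (hb.mono hq₅)).mp hab' _ _).mp
      ⟨forces_maps_funName g b q₅, hc⟩
    refine le_trans (Ordinal.ToType.mk.symm.le_iff_le.1 hle.le_of_ordLe)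
      (hz i b c q₅ ⟨(hq₅.trans hq₄q).trans hq, f, hf.mono hq₅, ?_, hc⟩)
    exact (EquivAt.maps .rfl' (ei.mono (hq₅.trans (hq₄.trans hq₃))) .rfl').iff.1
      (hxf.mono (hq₅.trans hq₄₁))
  have h₁ : dominatingNumber κ ≤ Cardinal.mk (Set.range z) := csInf_le' ⟨_, hdom, rfl⟩
  have h₂ : Cardinal.mk (Set.range z) ≤ o.card := by
    simpa using Cardinal.mk_range_le (f := z)
  exact (h₁.trans h₂).not_gt (Cardinal.lt_ord.1 ho)

/-- `ChainCondition.not_forces_isBijection` serves twice: for the ground-model family, it shows that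
𝔡_κ^V is still the least ordinal enumerating it, so no separate preservation of cardinals is needed;
for arbitrary families, it gives minimality. -/
theorem ChainCondition.forced_isDominatingNumber (hP : ChainCondition κ P) (hκ : κ.IsRegular) :
    Forced (isDominatingNumber (ordName P κ.ord) (ordName P (dominatingNumber κ).ord)) := by
  intro p
  obtain ⟨D, hD, hcard⟩ := exists_isDominating hκ
  have hdom := hP.forces_isDominating hκ hD
  refine ⟨.ex_intro (setName fun f : D => funName P f.1) ⟨hdom p, forces_isOrdinal_ordName _ p,
    ?_, fun a q _ ha => ?_⟩, fun n q _ hn r hr hnm => ?_⟩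
  · obtain ⟨e⟩ : Nonempty ((dominatingNumber κ).ord.ToType ≃ D) :=
      Cardinal.eq.1 (by rw [Cardinal.mk_ord_toType, hcard])
    rw [ordName_eq]
    exact .ex_intro _ (forces_isBijection_graphName (discrete_ordName _)
      (fun _ _ _ h => Subtype.ext (funName_inj h)) e p)
  · intro r hr h
    obtain ⟨s, hs, o, ho, e⟩ := (ha.mono hr).exists_of_mem_ordName
    obtain ⟨t, ht, b, hb⟩ := h s hs
    exact hP.not_forces_isBijection hκ ho (hdom t) (e.mono ht) hb
  · obtain ⟨s, hs, o, ho, e⟩ := hnm.exists_of_mem_ordName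
    obtain ⟨t, ht, E, hE, hcE⟩ := hn s (hs.trans hr)
    obtain ⟨v, hv, b, hb⟩ := hcE.2.1 t le_rfl
    exact hP.not_forces_isBijection hκ ho (hE.mono hv) (e.mono (hv.trans ht)) hb

end Bounding

end KForcing

/-! ### The two claims together -/

theorem lemma2p5 (κ : Cardinal.{u}) (hκ : κ.IsRegular) (hκ' : Cardinal.aleph0 < κ)
    (P : Type u) [Preorder P] (hP : KForcing.ChainCondition κ P) :
    KForcing.Forced (KForcing.Formula.isDominatingNumber
        (KForcing.ordName P κ.ord)
        (KForcing.ordName P (KForcing.dominatingNumber κ).ord)) ∧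
      ∀ x : KForcing.PName P, ∃ z : KForcing.Baire κ, ∀ α : κ.ord.ToType,
        KForcing.Forced (KForcing.Formula.imp
          (KForcing.Formula.isFunction x (KForcing.ordName P κ.ord) (KForcing.ordName P κ.ord))
          (KForcing.Formula.all fun y => KForcing.Formula.imp
            (KForcing.Formula.maps x (KForcing.ordName P (α.toOrd : Ordinal.{u})) y)
            (KForcing.Formula.ordLe y (KForcing.ordName P ((z α).toOrd : Ordinal.{u}))))) := by
  refine ⟨hP.forced_isDominatingNumber hκ, fun x => ?_⟩
  obtain ⟨z, hz⟩ := hP.exists_bounding hκ x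
  exact ⟨z, fun α _ q _ hx y r hr hy => hz α r y (hx.mono hr) hy⟩
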